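/- Let $(\mathcal V,g)$ be a spacetime: a connected Hausdorff smooth four-dimensional manifold with a smooth Lorentzian metric $g$ of signature $(-,+,+,+)$. Let $G_3$ be a group of motions of $(\mathcal V,g)$, given through its generators, i.e. a three-dimensional real Lie algebra of smooth Killing vector fields on $\mathcal V$, such that: - $G_3$ acts on $T_3$: at the points of a dense subset of $\mathcal V$ the vectors of $G_3$ span a three-dimensional timelike subspace of the tangent space (lower-dimensional orbits, as on an axis of symmetry, are allowed elsewhere); - $G_3$ is of Bianchi type II: it has a basis $e_0,e_1,e_2$ with $[e_1,e_2]=e_0$ and $[e_0,e_1]=[e_0,e_2]=0$; - $G_3$ contains an Abelian two-dimensional subalgebra $G_2$ that acts orthogonally transitively: $\boldsymbol X\wedge\boldsymbol Y\wedge \mathrm d\boldsymbol X=0$ and $\boldsymbol X\wedge\boldsymbol Y\wedge \mathrm d\boldsymbol Y=0$ on $\mathcal V$ for all $X,Y\in G_2$, where $\boldsymbol X=g(X,\cdot)$; - $G_2$ contains an axial Killing vector $\xi$: $\xi$ generates an effective smooth action of the circle group on $\mathcal V$ by isometries that has at least one fixed point. Call a vector field $s$ integrable if $\boldsymbol s\wedge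 \mathrm d\boldsymbol s=0$ on $\mathcal V$. Then every integrable Killing vector in $G_3$ belongs to $G_2$. In particular, no timelike integrable Killing vector exists in $G_3$; indeed no integrable element of $G_3$ is timelike at any point of $\mathcal V$. -/

import Mathlib

open scoped Manifold ContDiff

noncomputable section

namespace Spacetime

/-- Vector fields (not necessarily smooth) on a four-dimensional manifold. -/
abbrev VField (M : Type*) [TopologicalSpace M] [ChartedSpace (EuclideanSpace ℝ (Fin 4)) M] :=
  (p : M) → TangentSpace (𝓡 4) p

/-- A smooth Lorentzian metric of signature `(-,+,+,+)` on a four-dimensional smooth manifold. -/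
structure LorentzMetric (M : Type*) [TopologicalSpace M]
    [ChartedSpace (EuclideanSpace ℝ (Fin 4)) M] [IsManifold (𝓡 4) ∞ M] where
  /-- The scalar product on the tangent spaces. -/
  val (p : M) : TangentSpace (𝓡 4) p →L[ℝ] TangentSpace (𝓡 4) p →L[ℝ] ℝ
  symm (p : M) (v w : TangentSpace (𝓡 4) p) : val p v w = val p w v
  signature (p : M) : ∃ b : Module.Basis (Fin 4) ℝ (TangentSpace (𝓡 4) p),
    ∀ i j, val p (b i) (b j) = if i = j then (if i = 0 then -1 else 1) else 0
  contMDiff : ContMDiff (𝓡 4)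
    ((𝓡 4).prod 𝓘(ℝ, EuclideanSpace ℝ (Fin 4) →L[ℝ] EuclideanSpace ℝ (Fin 4) →L[ℝ] ℝ)) ∞
    (fun p : M ↦ Bundle.TotalSpace.mk'
      (EuclideanSpace ℝ (Fin 4) →L[ℝ] EuclideanSpace ℝ (Fin 4) →L[ℝ] ℝ)
      (E := fun p : M ↦ TangentSpace (𝓡 4) p →L[ℝ] TangentSpace (𝓡 4) p →L[ℝ] ℝ) p (val p))

section Basic

variable {M : Type*} [TopologicalSpace M] [ChartedSpace (EuclideanSpace ℝ (Fin 4)) M]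

/-- Smoothness of a vector field. -/
def IsSmooth [IsManifold (𝓡 4) ∞ M] (X : VField M) : Prop :=
  ContMDiff (𝓡 4) (𝓡 4).tangent ∞ (fun p ↦ (⟨p, X p⟩ : TangentBundle (𝓡 4) M))

/-- The Lie bracket `[X, Y]` of vector fields. -/
def bracket (X Y : VField M) : VField M := VectorField.mlieBracket (𝓡 4) X Y

/-- The derivative `X(f)` of a real function `f` along the vector field `X`. -/
def dirDeriv (X : VField M) (f : M → ℝ) (p : M) : ℝ := mvfderiv (𝓡 4) f p (X p)

/-- The exterior derivative of a 1-form, where forms are regarded as functions of vector fields: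
`dα(Y, Z) = Y(α(Z)) - Z(α(Y)) - α([Y, Z])`. -/
def extDer (α : VField M → M → ℝ) (Y Z : VField M) (p : M) : ℝ :=
  dirDeriv Y (α Z) p - dirDeriv Z (α Y) p - α (bracket Y Z) p

/-- The wedge product of two 1-forms. -/
def wedge₁₁ (α β : VField M → M → ℝ) (X Y : VField M) (p : M) : ℝ :=
  α X p * β Y p - α Y p * β X p

/-- The wedge product of a 1-form and a 2-form. -/
def wedge₁₂ (α : VField M → M → ℝ) (Φ : VField M → VField M → M → ℝ)
    (X Y Z : VField M) (p : M) : ℝ :=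
  α X p * Φ Y Z p - α Y p * Φ X Z p + α Z p * Φ X Y p

/-- The wedge product of two 2-forms. -/
def wedge₂₂ (Φ Ψ : VField M → VField M → M → ℝ) (X Y Z W : VField M) (p : M) : ℝ :=
  Φ X Y p * Ψ Z W p - Φ X Z p * Ψ Y W p + Φ X W p * Ψ Y Z p
    + Φ Y Z p * Ψ X W p - Φ Y W p * Ψ X Z p + Φ Z W p * Ψ X Y p

end Basic

section Killing

variable {M : Type*} [TopologicalSpace M] [ChartedSpace (EuclideanSpace ℝ (Fin 4)) M]
  [IsManifold (𝓡 4) ∞ M]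

/-- The function `g(X, Y)` of two vector fields. -/
def LorentzMetric.pair (g : LorentzMetric M) (X Y : VField M) (p : M) : ℝ := g.val p (X p) (Y p)

/-- The 1-form `g(X, ·)` metrically associated with a vector field `X`. -/
def LorentzMetric.flat (g : LorentzMetric M) (X : VField M) : VField M → M → ℝ :=
  fun Y p ↦ g.val p (X p) (Y p)

/-- Killing vector fields: smooth and with vanishing Lie derivative
`(L_X g)(Y, Z) = X(g(Y, Z)) - g([X, Y], Z) - g(Y, [X, Z])` of the metric. -/
def IsKilling (g : LorentzMetric M) (X : VField M) : Prop :=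
  IsSmooth X ∧ ∀ Y Z : VField M, IsSmooth Y → IsSmooth Z → ∀ p : M,
    dirDeriv X (g.pair Y Z) p - g.pair (bracket X Y) Z p - g.pair Y (bracket X Z) p = 0

/-- Integrable (hypersurface-orthogonal) vector fields: `s ∧ ds = 0` for the associated
1-form `s`. -/
def IsIntegrable (g : LorentzMetric M) (s : VField M) : Prop :=
  ∀ X Y Z : VField M, IsSmooth X → IsSmooth Y → IsSmooth Z → ∀ p : M,
    wedge₁₂ (g.flat s) (extDer (g.flat s)) X Y Z p = 0

/-- A `G_r` of motions, given through its generators: an `r`-dimensional Lie algebra of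
Killing vector fields. -/
structure IsMotionAlgebra (g : LorentzMetric M) (r : ℕ) (G : Submodule ℝ (VField M)) : Prop where
  killing : ∀ X ∈ G, IsKilling g X
  bracket_mem : ∀ X ∈ G, ∀ Y ∈ G, bracket X Y ∈ G
  finrank_eq : Module.finrank ℝ G = r

/-- Bianchi type II: there is a basis `e₀, e₁, e₂` with `[e₁, e₂] = e₀` and `e₀` central. -/
def IsBianchiII (G : Submodule ℝ (VField M)) : Prop :=
  ∃ e : Module.Basis (Fin 3) ℝ G,
    bracket (e 1 : VField M) (e 2) = e 0 ∧
    bracket (e 0 : VField M) (e 1) = 0 ∧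
    bracket (e 0 : VField M) (e 2) = 0

/-- The tangent space at `p` of the orbit of the group generated by `G`. -/
def orbitTangent (G : Submodule ℝ (VField M)) (p : M) : Submodule ℝ (TangentSpace (𝓡 4) p) :=
  G.map (LinearMap.proj p)

/-- The orbits are timelike hypersurfaces (`T₃`) at the points of a dense set. Lower-dimensional
orbits, as on an axis of symmetry, are allowed elsewhere. -/
def ActsOnT3 (g : LorentzMetric M) (G : Submodule ℝ (VField M)) : Prop :=
  Dense {p : M | Module.finrank ℝ (orbitTangent G p) = 3 ∧
    ∃ v ∈ orbitTangent G p, g.val p v v < 0}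

/-- Commutativity of a Lie algebra of vector fields. -/
def IsAbelian (K : Submodule ℝ (VField M)) : Prop :=
  ∀ X ∈ K, ∀ Y ∈ K, bracket X Y = 0

/-- Orthogonal transitivity of a `G₂`: for `X`, `Y` in it, the associated 1-forms satisfy
`X ∧ Y ∧ dX = 0` and `X ∧ Y ∧ dY = 0`. -/
def IsOrthogonallyTransitive (g : LorentzMetric M) (K : Submodule ℝ (VField M)) : Prop :=
  ∀ X ∈ K, ∀ Y ∈ K, ∀ A B C D : VField M,
    IsSmooth A → IsSmooth B → IsSmooth C → IsSmooth D → ∀ p : M,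
      wedge₂₂ (wedge₁₁ (g.flat X) (g.flat Y)) (extDer (g.flat X)) A B C D p = 0 ∧
      wedge₂₂ (wedge₁₁ (g.flat X) (g.flat Y)) (extDer (g.flat Y)) A B C D p = 0

/-- An axial symmetry: an effective smooth action of the one-dimensional torus by isometries, with
at least one fixed point. -/
structure IsAxialSymmetry (g : LorentzMetric M) (Φ : Circle → M → M) : Prop where
  map_one : ∀ p, Φ 1 p = p
  map_mul : ∀ a b p, Φ (a * b) p = Φ a (Φ b p)
  contMDiff : ContMDiff ((𝓡 1).prod (𝓡 4)) (𝓡 4) ∞ (fun x : Circle × M ↦ Φ x.1 x.2)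
  isometry : ∀ (a : Circle) (p : M) (v w : TangentSpace (𝓡 4) p),
    g.val (Φ a p) (mfderiv (𝓡 4) (𝓡 4) (Φ a) p v) (mfderiv (𝓡 4) (𝓡 4) (Φ a) p w) = g.val p v w
  effective : ∀ a : Circle, (∀ p, Φ a p = p) → a = 1
  exists_fixed : ∃ p, ∀ a : Circle, Φ a p = p

/-- An axial Killing vector: the infinitesimal generator of an axial symmetry. -/
def IsAxial (g : LorentzMetric M) (ξ : VField M) : Prop :=
  ∃ Φ : Circle → M → M, IsAxialSymmetry g Φ ∧
    ∀ p : M, IsMIntegralCurve (I := 𝓡 4) (fun θ : ℝ ↦ Φ (Circle.exp θ) p) ξ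

end Killing

end Spacetime

end

open Spacetime

/-!
In fact the algebra `G` contains no integrable Killing vector except zero, for the following reason.

Let `e₀, e₁, e₂` be a basis with `[e₁, e₂] = e₀` and `e₀` central, and let `ξ` be the axial element.

*The axial vector is central* (`IsAxial.coeff_eq_zero`). Suppose `[ξ, Y] = ζ ≠ 0` for some `Y` in
`G`. As `ζ` is central and `ξ` is Killing, `g(ζ, Y)` and `g(Y, Y)` are polynomials in the parameter
along each orbit of `ξ`; these orbits are closed, so the polynomials are constant and `ζ` is
orthogonal to itself and to `Y`. Varying `Y`, the vector `ζ` is orthogonal to all of `G`, in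
particular to a timelike vector wherever the orbits are timelike; a null vector orthogonal to a
timelike one is zero, although elements of `G` do not vanish where the orbits are three-dimensional.

*An integrable element makes the centre null*
(`pair_self_eq_zero_of_integrable_of_bracket`, `pair_self_eq_zero_of_integrable_central`).
If `s` is integrable and not central, choose `f` in `G` with `[f, s] = ζ ≠ 0`. The equation
`s ∧ ds = 0`, evaluated on the Killing vectors `s, f, ζ`, reads `g(s, s) g(ζ, ζ) = 2 g(s, ζ)²`.
Since `f(g(s, s)) = 2 g(s, ζ)`, `f(g(s, ζ)) = g(ζ, ζ)` and `f(g(ζ, ζ)) = 0`, two derivatives along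
`f` give `g(ζ, ζ)² = 0`. If `s ≠ 0` is central, then `s ∧ ds = 0` evaluated on `s` and two
elements with bracket `s` reads `g(s, s)² = 0`.

*An axial vector is not null* (`IsAxial.exists_pair_self_ne_zero`). Orbits close to a fixed point
stay in the domain of a function `t` with timelike gradient. Along a closed orbit `t` has a critical
point, where `ξ` is annihilated by `dt`; if `ξ` is null, it vanishes there, and the orbit is a
single point. So `ξ` would vanish near the fixed point, although it is nonzero on a dense set.
-/

namespace Spacetime

open Set Filter Topology

variable {M : Type*} [TopologicalSpace M] [ChartedSpace (EuclideanSpace ℝ (Fin 4)) M]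

/-! ### Scalar products and brackets of vector fields -/

lemma bracket_swap (X Y : VField M) : bracket X Y = -bracket Y X :=
  VectorField.mlieBracket_swap

@[simp] lemma bracket_self (X : VField M) : bracket X X = 0 :=
  VectorField.mlieBracket_self

lemma dirDeriv_zero (X : VField M) (p : M) : dirDeriv X 0 p = 0 := by
  have := mvfderiv_const (I := 𝓡 4) (0 : ℝ) (x := p)
  exact congrArg (fun L ↦ L (X p)) this

lemma dirDeriv_mul (X : VField M) {u v : M → ℝ} {p : M}
    (hu : MDifferentiableAt (𝓡 4) 𝓘(ℝ) u p) (hv : MDifferentiableAt (𝓡 4) 𝓘(ℝ) v p) :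
    dirDeriv X (u * v) p = u p * dirDeriv X v p + v p * dirDeriv X u p := by
  simp [dirDeriv, mvfderiv_mul hu hv]

variable [IsManifold (𝓡 4) ∞ M]

lemma LorentzMetric.contMDiffAt_pair (g : LorentzMetric M) {X Y : VField M} {p : M}
    (hX : ContMDiffAt (𝓡 4) (𝓡 4).tangent ∞ (fun p ↦ (⟨p, X p⟩ : TangentBundle (𝓡 4) M)) p)
    (hY : ContMDiffAt (𝓡 4) (𝓡 4).tangent ∞ (fun p ↦ (⟨p, Y p⟩ : TangentBundle (𝓡 4) M)) p) :
    ContMDiffAt (𝓡 4) 𝓘(ℝ) ∞ (g.pair X Y) p := by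
  have : ContMDiffAt (𝓡 4) ((𝓡 4).prod 𝓘(ℝ)) ∞
      (fun m ↦ Bundle.TotalSpace.mk' ℝ (E := Bundle.Trivial M ℝ) m (g.val m (X m) (Y m))) p := by
    apply ContMDiffAt.clm_bundle_apply₂ (F₁ := EuclideanSpace ℝ (Fin 4))
      (F₂ := EuclideanSpace ℝ (Fin 4))
    · exact g.contMDiff p
    · exact hX
    · exact hY
  rw [Bundle.contMDiffAt_totalSpace] at this
  exact this.2

lemma IsSmooth.mdifferentiableAt {X : VField M} (hX : IsSmooth X) (p : M) :
    MDifferentiableAt (𝓡 4) (𝓡 4).tangent (fun p ↦ (⟨p, X p⟩ : TangentBundle (𝓡 4) M)) p :=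
  (hX p).mdifferentiableAt (by simp)

lemma LorentzMetric.mdifferentiableAt_pair (g : LorentzMetric M) {X Y : VField M}
    (hX : IsSmooth X) (hY : IsSmooth Y) (p : M) :
    MDifferentiableAt (𝓡 4) 𝓘(ℝ) (g.pair X Y) p :=
  (g.contMDiffAt_pair (hX p) (hY p)).mdifferentiableAt (by simp)

lemma LorentzMetric.pair_comm (g : LorentzMetric M) (X Y : VField M) : g.pair X Y = g.pair Y X :=
  funext fun p ↦ g.symm p _ _

lemma LorentzMetric.pair_smul_left (g : LorentzMetric M) (c : ℝ) (X Y : VField M) :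
    g.pair (c • X) Y = c • g.pair X Y := by
  ext p; simp [LorentzMetric.pair]

lemma LorentzMetric.pair_add_right (g : LorentzMetric M) (X Y Y' : VField M) :
    g.pair X (Y + Y') = g.pair X Y + g.pair X Y' := by
  ext p; simp [LorentzMetric.pair]

lemma LorentzMetric.pair_smul_right (g : LorentzMetric M) (c : ℝ) (X Y : VField M) :
    g.pair X (c • Y) = c • g.pair X Y := by
  ext p; simp [LorentzMetric.pair]

@[simp] lemma LorentzMetric.pair_zero_left (g : LorentzMetric M) (Y : VField M) :
    g.pair 0 Y = 0 := by
  ext p; simp [LorentzMetric.pair]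

@[simp] lemma LorentzMetric.pair_zero_right (g : LorentzMetric M) (Y : VField M) :
    g.pair Y 0 = 0 := by
  ext p; simp [LorentzMetric.pair]

lemma LorentzMetric.pair_neg_right (g : LorentzMetric M) (X Y : VField M) :
    g.pair X (-Y) = -g.pair X Y := by
  ext p; simp [LorentzMetric.pair]

/-- The regularity that Mathlib requires for the algebraic properties of the Lie bracket. -/
instance : IsManifold (𝓡 4) (minSmoothness ℝ 2) M := by
  rw [minSmoothness_of_isRCLikeNormedField]
  exact IsManifold.of_le (n := ∞) (WithTop.coe_le_coe.2 le_top)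

lemma bracket_add_left {X X' : VField M} (Y : VField M) (hX : IsSmooth X) (hX' : IsSmooth X') :
    bracket (X + X') Y = bracket X Y + bracket X' Y :=
  funext fun p ↦ VectorField.mlieBracket_add_left (hX.mdifferentiableAt p) (hX'.mdifferentiableAt p)

lemma bracket_smul_left (c : ℝ) {X : VField M} (Y : VField M) (hX : IsSmooth X) :
    bracket (c • X) Y = c • bracket X Y :=
  funext fun p ↦ VectorField.mlieBracket_const_smul_left (hX.mdifferentiableAt p)

lemma bracket_add_right (X : VField M) {Y Y' : VField M} (hY : IsSmooth Y) (hY' : IsSmooth Y') :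
    bracket X (Y + Y') = bracket X Y + bracket X Y' :=
  funext fun p ↦ VectorField.mlieBracket_add_right (hY.mdifferentiableAt p)
    (hY'.mdifferentiableAt p)

lemma bracket_smul_right (c : ℝ) (X : VField M) {Y : VField M} (hY : IsSmooth Y) :
    bracket X (c • Y) = c • bracket X Y :=
  funext fun p ↦ VectorField.mlieBracket_const_smul_right (hY.mdifferentiableAt p)

lemma IsKilling.dirDeriv_pair {g : LorentzMetric M} {X Y Z : VField M} (hX : IsKilling g X)
    (hY : IsSmooth Y) (hZ : IsSmooth Z) (p : M) :
    dirDeriv X (g.pair Y Z) p = g.pair (bracket X Y) Z p + g.pair Y (bracket X Z) p := by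
  linarith [hX.2 Y Z hY hZ p]

/-! ### The central vector of a Heisenberg algebra with an integrable element is null -/

/-- The exterior derivative of the 1-form of a vector field, evaluated on two Killing vectors. -/
lemma IsKilling.extDer_flat {g : LorentzMetric M} {s X Y : VField M} (hs : IsSmooth s)
    (hX : IsKilling g X) (hY : IsKilling g Y) (p : M) :
    extDer (g.flat s) X Y p =
      g.pair (bracket X s) Y p - g.pair (bracket Y s) X p + g.pair s (bracket X Y) p := by
  have h1 := hX.dirDeriv_pair hs hY.1 p
  have h2 := hY.dirDeriv_pair hs hX.1 p
  rw [bracket_swap Y X, g.pair_neg_right] at h2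
  simp only [Pi.neg_apply] at h2
  change dirDeriv X (g.pair s Y) p - dirDeriv Y (g.pair s X) p - g.pair s (bracket X Y) p = _
  rw [h1, h2]; ring

/-- If `[f, s] = ζ` is central and `s` is integrable, then `s ∧ ds = 0` evaluated on `s, f, ζ`
reads `g(s, s) g(ζ, ζ) = 2 g(s, ζ)²`. Differentiating twice along `f` gives `g(ζ, ζ)² = 0`. -/
lemma pair_self_eq_zero_of_integrable_of_bracket {g : LorentzMetric M} {s f ζ : VField M}
    (hs : IsKilling g s) (hf : IsKilling g f) (hζ : IsKilling g ζ)
    (hfs : bracket f s = ζ) (hζs : bracket ζ s = 0) (hζf : bracket ζ f = 0)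
    (hint : IsIntegrable g s) : g.pair ζ ζ = 0 := by
  have hsf : bracket s f = -ζ := by rw [bracket_swap, hfs]
  have hsζ : bracket s ζ = 0 := by rw [bracket_swap, hζs, neg_zero]
  have hfζ : bracket f ζ = 0 := by rw [bracket_swap, hζf, neg_zero]
  have key : g.pair s s * g.pair ζ ζ = g.pair s ζ * (g.pair s ζ + g.pair s ζ) := by
    ext p
    have h := hint s f ζ hs.1 hf.1 hζ.1 p
    simp only [wedge₁₂, IsKilling.extDer_flat hs.1 hf hζ, IsKilling.extDer_flat hs.1 hs hζ,
      IsKilling.extDer_flat hs.1 hs hf, hfs, hsf, hsζ, hfζ, hζs, bracket_self, g.pair_neg_right,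
      g.pair_zero_left, g.pair_zero_right, Pi.neg_apply, Pi.zero_apply] at h
    rw [g.pair_comm ζ s] at h
    simp only [Pi.mul_apply, Pi.add_apply]
    change g.pair s s p * _ - g.pair s f p * _ + g.pair s ζ p * _ = 0 at h
    linear_combination h
  have dss (p) : dirDeriv f (g.pair s s) p = 2 * g.pair s ζ p := by
    rw [hf.dirDeriv_pair hs.1 hs.1, hfs, g.pair_comm ζ s]; ring
  have dsζ (p) : dirDeriv f (g.pair s ζ) p = g.pair ζ ζ p := by
    rw [hf.dirDeriv_pair hs.1 hζ.1, hfs, hfζ]; simp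
  have dζζ (p) : dirDeriv f (g.pair ζ ζ) p = 0 := by
    rw [hf.dirDeriv_pair hζ.1 hζ.1, hfζ]; simp
  have mss := g.mdifferentiableAt_pair hs.1 hs.1
  have msζ := g.mdifferentiableAt_pair hs.1 hζ.1
  have mζζ := g.mdifferentiableAt_pair hζ.1 hζ.1
  have first : g.pair s ζ * g.pair ζ ζ = 0 := by
    ext p
    have h := congrArg (fun u ↦ dirDeriv f u p) key
    have hadd : dirDeriv f (g.pair s ζ + g.pair s ζ) p = 2 * g.pair ζ ζ p := by
      have := dsζ p
      simp only [dirDeriv] at this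
      simp [dirDeriv, mvfderiv_add (msζ p) (msζ p), this, two_mul]
    simp only [dirDeriv_mul f (mss p) (mζζ p), dirDeriv_mul f (msζ p) ((msζ p).add (msζ p)),
      dss, dsζ, dζζ, hadd, Pi.add_apply] at h
    simp only [Pi.mul_apply, Pi.zero_apply]
    linarith
  ext p
  have h := congrArg (fun u ↦ dirDeriv f u p) first
  simp only [dirDeriv_mul f (msζ p) (mζζ p), dsζ, dζζ, dirDeriv_zero] at h
  simpa using h

/-- If `[X, Y] = ζ` is central and integrable, then `ζ ∧ dζ = 0` evaluated on `ζ, X, Y` reads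
`g(ζ, ζ)² = 0`. -/
lemma pair_self_eq_zero_of_integrable_central {g : LorentzMetric M} {ζ X Y : VField M}
    (hζ : IsKilling g ζ) (hX : IsKilling g X) (hY : IsKilling g Y)
    (hXY : bracket X Y = ζ) (hζX : bracket ζ X = 0) (hζY : bracket ζ Y = 0)
    (hint : IsIntegrable g ζ) : g.pair ζ ζ = 0 := by
  have hXζ : bracket X ζ = 0 := by rw [bracket_swap, hζX, neg_zero]
  have hYζ : bracket Y ζ = 0 := by rw [bracket_swap, hζY, neg_zero]
  ext p
  have h := hint ζ X Y hζ.1 hX.1 hY.1 p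
  simp only [wedge₁₂, IsKilling.extDer_flat hζ.1 hX hY, IsKilling.extDer_flat hζ.1 hζ hX,
    IsKilling.extDer_flat hζ.1 hζ hY, hXζ, hYζ, hζX, hζY, hXY, bracket_self,
    g.pair_zero_left, g.pair_zero_right, Pi.zero_apply] at h
  change g.pair ζ ζ p * _ - _ + _ = 0 at h
  simpa using h

/-! ### Functions along the orbits of an axial Killing vector -/

omit [IsManifold (𝓡 4) ∞ M] in
lemma IsMIntegralCurve.hasDerivAt_comp {γ : ℝ → M} {X : VField M}
    (hγ : IsMIntegralCurve (I := 𝓡 4) γ X) {u : M → ℝ} {t : ℝ}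
    (hu : MDifferentiableAt (𝓡 4) 𝓘(ℝ) u (γ t)) :
    HasDerivAt (u ∘ γ) (dirDeriv X u (γ t)) t := by
  have h : HasFDerivAt (u ∘ γ)
      (mvfderiv (𝓡 4) u (γ t) ∘L (1 : ℝ →L[ℝ] ℝ).smulRight (X (γ t))) t :=
    (hu.hasMFDerivAt.comp t (hγ t)).hasFDerivAt
  simpa [dirDeriv] using h.hasDerivAt

/-- A function `v` that is constant along the orbits of an axial Killing vector `ξ` and a multiple
of which is a derivative `ξ(u)` vanishes: `u` is periodic along each orbit. -/
lemma IsAxial.eq_zero_of_dirDeriv_eq {g : LorentzMetric M} {ξ : VField M} (hξ : IsAxial g ξ)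
    {u v : M → ℝ} (hu : MDifferentiable (𝓡 4) 𝓘(ℝ) u) (hv : MDifferentiable (𝓡 4) 𝓘(ℝ) v)
    {c : ℝ} (hc : c ≠ 0) (huv : ∀ p, dirDeriv ξ u p = c * v p) (hv0 : ∀ p, dirDeriv ξ v p = 0) :
    v = 0 := by
  obtain ⟨Φ, hΦ, hcurve⟩ := hξ
  ext p
  have hd (θ) := (hcurve p).hasDerivAt_comp (hu _) (t := θ)
  have hd' (θ) := (hcurve p).hasDerivAt_comp (hv _) (t := θ)
  simp only [hv0] at hd'
  simp only [huv] at hd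
  obtain ⟨θ, -, hθ⟩ := exists_hasDerivAt_eq_zero Real.two_pi_pos
    (fun θ _ ↦ (hd θ).continuousAt.continuousWithinAt) (by simp) (fun θ _ ↦ hd θ)
  have := is_const_of_deriv_eq_zero (fun θ ↦ (hd' θ).differentiableAt) (fun θ ↦ (hd' θ).deriv) θ 0
  simp only [Function.comp_apply, (mul_eq_zero.1 hθ).resolve_left hc, Circle.exp_zero,
    hΦ.map_one] at this
  exact this.symm

/-- An integral curve of a smooth vector field through a zero of that field is constant. -/
lemma IsMIntegralCurve.eq_const [T2Space M] {γ : ℝ → M} {X : VField M} (hX : IsSmooth X)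
    (hγ : IsMIntegralCurve (I := 𝓡 4) γ X) {t : ℝ} (ht : X (γ t) = 0) : γ = fun _ ↦ γ t :=
  isMIntegralCurve_Ioo_eq_of_contMDiff_boundaryless (t₀ := t)
    (ContMDiff.of_le hX (by simp)) hγ (isMIntegralCurve_const ht) rfl

/-- An axial Killing vector is not zero, since the circle acts effectively. -/
lemma IsAxial.ne_zero [T2Space M] {g : LorentzMetric M} {ξ : VField M} (hs : IsSmooth ξ)
    (hξ : IsAxial g ξ) : ξ ≠ 0 := by
  rintro rfl
  obtain ⟨Φ, hΦ, hcurve⟩ := hξ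
  -- The rotation by the angle `π` would act trivially.
  have h : Circle.exp Real.pi = 1 := hΦ.effective _ fun p ↦ by
    have := congrFun ((hcurve p).eq_const hs (t := 0) rfl) Real.pi
    simpa [hΦ.map_one] using this
  have := congrArg (Subtype.val) h
  simp at this
  norm_num at this
/-! ### Null vectors in a Lorentzian manifold -/

lemma LorentzMetric.val_eq_sum (g : LorentzMetric M) {p : M}
    (b : Module.Basis (Fin 4) ℝ (TangentSpace (𝓡 4) p)) (v w : TangentSpace (𝓡 4) p) :
    g.val p v w = ∑ i, ∑ j, b.repr v i * b.repr w j * g.val p (b i) (b j) := by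
  conv_lhs => rw [← b.sum_repr v, ← b.sum_repr w]
  simp only [map_sum, map_smul, _root_.sum_apply, _root_.smul_apply, smul_eq_mul, Finset.mul_sum]
  rw [Finset.sum_comm]
  exact Finset.sum_congr rfl fun i _ ↦ Finset.sum_congr rfl fun j _ ↦ by ring

/-- A nonzero vector orthogonal to a timelike vector is spacelike. -/
lemma LorentzMetric.val_self_pos_of_orthogonal (g : LorentzMetric M) {p : M}
    {v w : TangentSpace (𝓡 4) p} (hv : g.val p v v < 0) (hvw : g.val p v w = 0) (hw : w ≠ 0) :
    0 < g.val p w w := by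
  obtain ⟨b, hb⟩ := g.signature p
  rw [g.val_eq_sum b] at hv hvw ⊢
  have hw' : b.repr w ≠ 0 := by simpa using hw
  simp only [hb, Fin.sum_univ_four] at hv hvw ⊢
  generalize b.repr v = x at *
  generalize b.repr w = y at *
  simp only [Fin.reduceEq, if_true, if_false, zero_ne_one, one_ne_zero] at hv hvw ⊢
  have hne : y 0 ≠ 0 ∨ y 1 ≠ 0 ∨ y 2 ≠ 0 ∨ y 3 ≠ 0 := by
    by_contra! h
    exact hw' (Finsupp.ext fun i ↦ by fin_cases i <;> simp [h])
  have hx0 : x 1 ^ 2 + x 2 ^ 2 + x 3 ^ 2 < x 0 ^ 2 := by linarith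
  have hxy : x 0 * y 0 = x 1 * y 1 + x 2 * y 2 + x 3 * y 3 := by linarith
  have cs : (x 1 * y 1 + x 2 * y 2 + x 3 * y 3) ^ 2 ≤
      (x 1 ^ 2 + x 2 ^ 2 + x 3 ^ 2) * (y 1 ^ 2 + y 2 ^ 2 + y 3 ^ 2) := by
    nlinarith [sq_nonneg (x 1 * y 2 - x 2 * y 1), sq_nonneg (x 1 * y 3 - x 3 * y 1),
      sq_nonneg (x 2 * y 3 - x 3 * y 2)]
  rw [← hxy, mul_pow] at cs
  suffices h : y 0 ^ 2 < y 1 ^ 2 + y 2 ^ 2 + y 3 ^ 2 by linarith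
  have hX : 0 ≤ x 1 ^ 2 + x 2 ^ 2 + x 3 ^ 2 := by positivity
  rcases (show 0 ≤ y 1 ^ 2 + y 2 ^ 2 + y 3 ^ 2 by positivity).eq_or_lt with hY | hY
  · exfalso
    have h0 : y 0 ^ 2 ≤ 0 := by
      rw [← hY, mul_zero] at cs
      by_contra! h
      have : 0 < x 0 ^ 2 * y 0 ^ 2 := mul_pos (by linarith) h
      linarith
    have := sq_nonneg (y 0); have := sq_nonneg (y 1); have := sq_nonneg (y 2)
    have := sq_nonneg (y 3)
    rcases hne with h | h | h | h <;> have := pow_pos (abs_pos.2 h) 2 <;> rw [sq_abs] at this <;>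
      linarith
  · have : (x 1 ^ 2 + x 2 ^ 2 + x 3 ^ 2) * (y 1 ^ 2 + y 2 ^ 2 + y 3 ^ 2) <
        x 0 ^ 2 * (y 1 ^ 2 + y 2 ^ 2 + y 3 ^ 2) := mul_lt_mul_of_pos_right hx0 hY
    exact lt_of_mul_lt_mul_left (cs.trans_lt this) (by positivity)

/-- Near every point there is a time function `t`: vectors on which `dt` vanishes are spacelike.
It is the coordinate of a chart along the timelike vector of an orthonormal basis at the point;
in a neighbourhood, the frame induced by the chart is close to being orthonormal. -/
lemma LorentzMetric.exists_local_time_function (g : LorentzMetric M) (p₀ : M) :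
    ∃ t : M → ℝ, ∀ᶠ q in 𝓝 p₀, MDifferentiableAt (𝓡 4) 𝓘(ℝ) t q ∧
      ∀ v : TangentSpace (𝓡 4) q, mvfderiv (𝓡 4) t q v = 0 → v ≠ 0 → 0 < g.val q v v := by
  obtain ⟨b, hb⟩ := g.signature p₀
  let e := trivializationAt (EuclideanSpace ℝ (Fin 4)) (TangentSpace (𝓡 4) : M → Type _) p₀
  have hp₀ : p₀ ∈ e.baseSet := FiberBundle.mem_baseSet_trivializationAt' p₀
  let bE : Module.Basis (Fin 4) ℝ (EuclideanSpace ℝ (Fin 4)) :=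
    b.map (e.linearEquivAt ℝ p₀ hp₀)
  let B : Fin 4 → VField M := e.localFrame bE
  have hB (i) : B i p₀ = b i := by
    simp [B, Bundle.Trivialization.localFrame_apply_of_mem_baseSet, hp₀, bE,
      Bundle.Trivialization.basisAt]
  -- With entries within `1 / 4` of the Minkowski ones, the spatial block of the Gram matrix is at
  -- least `1 / 4`, since its nine entries change `∑ cᵢ²` by at most `(3 / 4) ∑ cᵢ²`.
  have hclose (i j) : ∀ᶠ q in 𝓝 p₀,
      |g.pair (B i) (B j) q - if i = j then (if i = 0 then -1 else 1) else 0| < 1 / 4 := by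
    have hc : ContinuousAt (g.pair (B i) (B j)) p₀ :=
      (g.contMDiffAt_pair (contMDiffAt_localFrame_of_mem ∞ e bE i hp₀)
        (contMDiffAt_localFrame_of_mem ∞ e bE j hp₀)).continuousAt
    have := Metric.tendsto_nhds.1 hc.tendsto (1 / 4) (by norm_num)
    simpa only [Real.dist_eq, LorentzMetric.pair, hB, hb] using this
  let ℓ : EuclideanSpace ℝ (Fin 4) →L[ℝ] ℝ := LinearMap.toContinuousLinearMap (bE.coord 0)
  refine ⟨fun q ↦ ℓ (extChartAt (𝓡 4) p₀ q), ?_⟩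
  filter_upwards [eventually_all.2 fun i ↦ eventually_all.2 (hclose i),
    e.open_baseSet.mem_nhds hp₀] with q hq hqe
  have hqc : q ∈ (chartAt (EuclideanSpace ℝ (Fin 4)) p₀).source := by
    simpa [e] using hqe
  have hext : MDifferentiableAt (𝓡 4) 𝓘(ℝ, EuclideanSpace ℝ (Fin 4)) (extChartAt (𝓡 4) p₀) q :=
    mdifferentiableAt_extChartAt hqc
  have hd := ℓ.hasMFDerivAt.comp q hext.hasMFDerivAt
  refine ⟨hd.mdifferentiableAt, fun v hv hv0 ↦ ?_⟩
  -- The differential of `t` is the component along the timelike vector of the frame.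
  let c := (e.basisAt bE hqe).repr v
  have hc0 : c 0 = 0 := by
    rw [← hv]
    have h1 : mvfderiv (𝓡 4) (fun q ↦ ℓ (extChartAt (𝓡 4) p₀ q)) q v =
        ℓ (mfderiv (𝓡 4) 𝓘(ℝ, EuclideanSpace ℝ (Fin 4)) (extChartAt (𝓡 4) p₀) q v) := by
      have := hd.mfderiv
      simp only [mvfderiv]
      change (mfderiv (𝓡 4) 𝓘(ℝ) (ℓ ∘ extChartAt (𝓡 4) p₀) q) v = _
      rw [this]
      rfl
    rw [h1, ← TangentBundle.continuousLinearMapAt_trivializationAt hqc]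
    have h2 : e.continuousLinearMapAt ℝ q v = (e ⟨q, v⟩).2 := by
      rw [Bundle.Trivialization.continuousLinearMapAt_apply, e.coe_linearMapAt_of_mem hqe]
    have h3 : c = bE.repr (e ⟨q, v⟩).2 := by simp [c, Bundle.Trivialization.basisAt]
    rw [h3]
    exact congrArg (fun w ↦ bE.repr w 0) h2.symm
  rw [g.val_eq_sum (e.basisAt bE hqe)]
  have hg (i j) : |g.val q (e.basisAt bE hqe i) (e.basisAt bE hqe j) -
      if i = j then (if i = 0 then -1 else 1) else 0| < 1 / 4 := by
    simpa [LorentzMetric.pair, B, hqe] using hq i j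
  have hcne : c ≠ 0 := by simpa [c] using hv0
  change 0 < ∑ i, ∑ j, c i * c j * _
  have hterm (i j) (x : ℝ) (hx : |x| < 1 / 4) : -((c i ^ 2 + c j ^ 2) / 8) ≤ c i * c j * x := by
    obtain ⟨h1, h2⟩ := abs_lt.1 hx
    nlinarith [mul_nonneg (sq_nonneg (c i + c j)) (by linarith : 0 ≤ x + 1 / 4),
      mul_nonneg (sq_nonneg (c i - c j)) (by linarith : 0 ≤ 1 / 4 - x)]
  have hpos : 0 < c 1 ^ 2 + c 2 ^ 2 + c 3 ^ 2 := by
    by_contra! h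
    have h1 := sq_nonneg (c 1)
    have h2 := sq_nonneg (c 2)
    have h3 := sq_nonneg (c 3)
    have z1 : c 1 = 0 := pow_eq_zero_iff two_ne_zero |>.1 (by linarith)
    have z2 : c 2 = 0 := pow_eq_zero_iff two_ne_zero |>.1 (by linarith)
    have z3 : c 3 = 0 := pow_eq_zero_iff two_ne_zero |>.1 (by linarith)
    refine hcne (Finsupp.ext fun i ↦ ?_)
    fin_cases i
    exacts [hc0, z1, z2, z3]
  have hsum (i j) := hterm i j _ (hg i j)
  have h11 := hsum 1 1
  have h12 := hsum 1 2
  have h13 := hsum 1 3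
  have h21 := hsum 2 1
  have h22 := hsum 2 2
  have h23 := hsum 2 3
  have h31 := hsum 3 1
  have h32 := hsum 3 2
  have h33 := hsum 3 3
  simp only [Fin.reduceEq, if_true, if_false] at h11 h12 h13 h21 h22 h23 h31 h32 h33
  simp only [Fin.sum_univ_four, hc0]
  linarith

/-- An axial Killing vector is not everywhere null and nonzero on a dense set: an orbit close to a
fixed point lies in the domain of a time function, which has a critical point along the closed
orbit; there `ξ` is null and annihilated by `dt`, so `ξ` vanishes and the orbit is a point. -/
lemma IsAxial.exists_pair_self_ne_zero [T2Space M] {g : LorentzMetric M} {ξ : VField M}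
    (hs : IsSmooth ξ) (hξ : IsAxial g ξ) (hd : Dense {p | ξ p ≠ 0}) : g.pair ξ ξ ≠ 0 := by
  intro hnull
  obtain ⟨Φ, hΦ, hcurve⟩ := hξ
  obtain ⟨p₀, hp₀⟩ := hΦ.exists_fixed
  obtain ⟨t, ht⟩ := g.exists_local_time_function p₀
  obtain ⟨U, hU, hUo, hpU⟩ := eventually_nhds_iff.1 ht
  obtain ⟨V, W, -, hW, hV, hpW, hVW⟩ := generalized_tube_lemma (isCompact_univ (X := Circle))
    (isCompact_singleton (x := p₀)) (hUo.preimage hΦ.contMDiff.continuous)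
    (by rintro ⟨a, p⟩ ⟨-, rfl⟩; simpa [hp₀] using hpU)
  obtain ⟨q, hq, hqW⟩ := hd.exists_mem_open hW ⟨p₀, hpW rfl⟩
  have hmem (θ : ℝ) : Φ (Circle.exp θ) q ∈ U :=
    hVW (mk_mem_prod (hV (mem_univ (Circle.exp θ))) hqW)
  have hderiv (θ) := (hcurve q).hasDerivAt_comp (hU _ (hmem θ)).1
  obtain ⟨θ, -, hθ⟩ := exists_hasDerivAt_eq_zero Real.two_pi_pos
    (fun θ _ ↦ (hderiv θ).continuousAt.continuousWithinAt) (by simp) (fun θ _ ↦ hderiv θ)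
  have hzero : ξ (Φ (Circle.exp θ) q) = 0 := by
    by_contra h
    exact ((hU _ (hmem θ)).2 _ hθ h).ne' (congrFun hnull _)
  have hconst := congrFun ((hcurve q).eq_const hs hzero) 0
  simp only [Circle.exp_zero, hΦ.map_one] at hconst
  exact hq (by rw [hconst]; exact hzero)
/-! ### Motion algebras of Bianchi type II with an axial element -/

/-- At a point with an orbit of full dimension, nonzero elements of the algebra do not vanish. -/
lemma IsMotionAlgebra.ne_zero_of_finrank_orbitTangent {g : LorentzMetric M} {r : ℕ}
    {G : Submodule ℝ (VField M)} (hG : IsMotionAlgebra g (r + 1) G) {p : M}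
    (hp : Module.finrank ℝ (orbitTangent G p) = r + 1) {X : VField M} (hX : X ∈ G) (hX0 : X ≠ 0) :
    X p ≠ 0 := by
  have : FiniteDimensional ℝ G :=
    FiniteDimensional.of_finrank_pos (by rw [hG.finrank_eq]; exact r.succ_pos)
  let ev : G →ₗ[ℝ] TangentSpace (𝓡 4) p := (LinearMap.proj p).domRestrict G
  have hrange : LinearMap.range ev = orbitTangent G p := LinearMap.range_domRestrict _ _
  have hker : LinearMap.ker ev = ⊥ := by
    have := ev.finrank_range_add_finrank_ker
    rw [hrange, hp, hG.finrank_eq] at this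
    exact Submodule.finrank_eq_zero.1 (by omega)
  intro h
  have h0 : (⟨X, hX⟩ : G) ∈ LinearMap.ker ev := h
  rw [hker, Submodule.mem_bot] at h0
  exact hX0 (congrArg Subtype.val h0)

/-- In a Heisenberg algebra, brackets are given by the standard symplectic form. -/
lemma bracket_eq_of_heisenberg {e₀ e₁ e₂ : VField M} (h₀ : IsSmooth e₀) (h₁ : IsSmooth e₁)
    (h₂ : IsSmooth e₂) (h₁₂ : bracket e₁ e₂ = e₀) (h₀₁ : bracket e₀ e₁ = 0)
    (h₀₂ : bracket e₀ e₂ = 0) (a b c a' b' c' : ℝ)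
    (hsm : ∀ a b c : ℝ, IsSmooth (a • e₀ + b • e₁ + c • e₂)) :
    bracket (a • e₀ + b • e₁ + c • e₂) (a' • e₀ + b' • e₁ + c' • e₂) =
      (b * c' - c * b') • e₀ := by
  have s₀ (a : ℝ) : IsSmooth (a • e₀) := by simpa using hsm a 0 0
  have s₁ (a : ℝ) : IsSmooth (a • e₁) := by simpa using hsm 0 a 0
  have s₂ (a : ℝ) : IsSmooth (a • e₂) := by simpa using hsm 0 0 a
  have s₀₁ (a b : ℝ) : IsSmooth (a • e₀ + b • e₁) := by simpa using hsm a b 0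
  have h₂₁ : bracket e₂ e₁ = -e₀ := by rw [bracket_swap, h₁₂]
  have h₁₀ : bracket e₁ e₀ = 0 := by rw [bracket_swap, h₀₁, neg_zero]
  have h₂₀ : bracket e₂ e₀ = 0 := by rw [bracket_swap, h₀₂, neg_zero]
  simp only [bracket_add_left _ (s₀₁ _ _) (s₂ _), bracket_add_left _ (s₀ _) (s₁ _),
    bracket_add_right _ (s₀₁ _ _) (s₂ _), bracket_add_right _ (s₀ _) (s₁ _),
    bracket_smul_left _ _ h₀, bracket_smul_left _ _ h₁, bracket_smul_left _ _ h₂,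
    bracket_smul_right _ _ h₀, bracket_smul_right _ _ h₁, bracket_smul_right _ _ h₂,
    bracket_self, h₁₂, h₀₁, h₀₂, h₂₁, h₁₀, h₂₀]
  module

/-- If an axial Killing vector `ξ` does not commute with some element, say `[ξ, Y] = ζ ≠ 0`,
then along the orbits of `ξ` the scalar products `g(ζ, Y)`, `g(Y, Y)` are polynomials in the
parameter, of degrees one and two. Being periodic, they are constant; so `ζ` is null and
orthogonal to `Y`. -/
lemma IsAxial.pair_eq_zero_of_bracket {g : LorentzMetric M} {ξ Y ζ : VField M}
    (hax : IsAxial g ξ) (hξ : IsKilling g ξ) (hY : IsSmooth Y) (hζ : IsSmooth ζ)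
    (hξY : bracket ξ Y = ζ) (hξζ : bracket ξ ζ = 0) :
    g.pair ζ ζ = 0 ∧ g.pair ζ Y = 0 := by
  have hζζ : g.pair ζ ζ = 0 :=
    hax.eq_zero_of_dirDeriv_eq (g.mdifferentiableAt_pair hζ hY) (g.mdifferentiableAt_pair hζ hζ)
      one_ne_zero (fun p ↦ by simp [hξ.dirDeriv_pair hζ hY, hξY, hξζ])
      (fun p ↦ by simp [hξ.dirDeriv_pair hζ hζ, hξζ])
  refine ⟨hζζ, hax.eq_zero_of_dirDeriv_eq (g.mdifferentiableAt_pair hY hY)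
    (g.mdifferentiableAt_pair hζ hY) two_ne_zero (fun p ↦ ?_) (fun p ↦ ?_)⟩
  · rw [hξ.dirDeriv_pair hY hY, hξY, g.pair_comm Y ζ, two_mul]
  · simp [hξ.dirDeriv_pair hζ hY, hξY, hξζ, hζζ]

/-- An axial element of a motion algebra of Bianchi type II on timelike orbits is central.
Otherwise the derived algebra, spanned by `e₀`, would be orthogonal to the whole algebra, hence
to a timelike vector at some point, and null at the same time. -/
lemma IsAxial.coeff_eq_zero {g : LorentzMetric M} {G : Submodule ℝ (VField M)}
    (hG : IsMotionAlgebra g 3 G) {p : M} (hp : Module.finrank ℝ (orbitTangent G p) = 3)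
    (hT : ∃ v ∈ orbitTangent G p, g.val p v v < 0) {e₀ e₁ e₂ : VField M} (h₀ : e₀ ∈ G)
    (h₁ : e₁ ∈ G) (h₂ : e₂ ∈ G) (hne : e₀ ≠ 0) (h₁₂ : bracket e₁ e₂ = e₀)
    (h₀₁ : bracket e₀ e₁ = 0) (h₀₂ : bracket e₀ e₂ = 0)
    (hspan : ∀ X ∈ G, ∃ a b c : ℝ, X = a • e₀ + b • e₁ + c • e₂) {a b c : ℝ}
    (hax : IsAxial g (a • e₀ + b • e₁ + c • e₂)) : b = 0 ∧ c = 0 := by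
  have hmem (a b c : ℝ) : a • e₀ + b • e₁ + c • e₂ ∈ G :=
    add_mem (add_mem (G.smul_mem _ h₀) (G.smul_mem _ h₁)) (G.smul_mem _ h₂)
  have hkill (X) (hX : X ∈ G) := hG.killing X hX
  have hbr (a b c a' b' c' : ℝ) := bracket_eq_of_heisenberg (hkill _ h₀).1 (hkill _ h₁).1
    (hkill _ h₂).1 h₁₂ h₀₁ h₀₂ a b c a' b' c' fun a b c ↦ (hkill _ (hmem a b c)).1
  by_contra hbc
  have hpos : 0 < b ^ 2 + c ^ 2 := by
    have : b ≠ 0 ∨ c ≠ 0 := not_and_or.1 hbc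
    rcases this with h | h <;> positivity
  have horth (a' b' c' : ℝ) (hd : b * c' - c * b' ≠ 0) :
      g.pair e₀ e₀ = 0 ∧ g.pair e₀ (a' • e₀ + b' • e₁ + c' • e₂) = 0 := by
    have h := hax.pair_eq_zero_of_bracket (hkill _ (hmem a b c)) (hkill _ (hmem a' b' c')).1
      (hkill _ (G.smul_mem _ h₀)).1 (hbr a b c a' b' c')
      (by simpa using hbr a b c (b * c' - c * b') 0 0)
    simpa only [g.pair_smul_left, g.pair_smul_right, smul_eq_zero, hd, false_or] using h
  have hYd : b * b - c * -c ≠ 0 := by nlinarith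
  have hY := horth 0 (-c) b hYd
  have hall (X) (hX : X ∈ G) : g.pair e₀ X = 0 := by
    obtain ⟨a', b', c', rfl⟩ := hspan X hX
    by_cases hd : b * c' - c * b' = 0
    · -- Adding an element that does not commute with the axial one reduces to the other case.
      have h := (horth (a' + 0) (b' + -c) (c' + b) (by
        rwa [show b * (c' + b) - c * (b' + -c) = b * b - c * -c by linear_combination hd])).2
      rw [show (a' + 0) • e₀ + (b' + -c) • e₁ + (c' + b) • e₂ =
        (a' • e₀ + b' • e₁ + c' • e₂) + ((0 : ℝ) • e₀ + -c • e₁ + b • e₂) by module,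
        g.pair_add_right, hY.2, add_zero] at h
      exact h
    · exact (horth a' b' c' hd).2
  obtain ⟨v, hv, hvv⟩ := hT
  obtain ⟨X, hX, rfl⟩ := hv
  have := g.val_self_pos_of_orthogonal hvv
    (by rw [g.symm]; exact congrFun (hall X hX) p) (hG.ne_zero_of_finrank_orbitTangent hp h₀ hne)
  exact this.ne' (congrFun hY.1 p)

/-- A motion algebra of Bianchi type II on timelike orbits with an axial element `ξ` contains no
integrable Killing vector other than zero. Indeed `ξ` spans the centre, so an integrable `s ≠ 0`
would make `ξ` null, either as a multiple of a bracket `[f, s]` or as a multiple of `s`. -/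
theorem eq_zero_of_integrable_of_axial [T2Space M] [Nonempty M] {g : LorentzMetric M}
    {G : Submodule ℝ (VField M)} (hG : IsMotionAlgebra g 3 G) (hT : ActsOnT3 g G)
    (hII : IsBianchiII G) {ξ : VField M} (hξ : ξ ∈ G) (hax : IsAxial g ξ) {s : VField M}
    (hs : s ∈ G) (hint : IsIntegrable g s) : s = 0 := by
  obtain ⟨e, h₁₂, h₀₁, h₀₂⟩ := hII
  have hspan (X) (hX : X ∈ G) :
      ∃ a b c : ℝ, X = a • (e 0 : VField M) + b • (e 1 : VField M) + c • (e 2 : VField M) := by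
    have := congrArg Subtype.val (e.sum_repr ⟨X, hX⟩)
    rw [Fin.sum_univ_three] at this
    exact ⟨_, _, _, this.symm⟩
  have h₀ := (e 0).2
  have h₁ := (e 1).2
  have h₂ := (e 2).2
  have hne : (e 0 : VField M) ≠ 0 := fun h ↦ e.ne_zero 0 (Subtype.ext h)
  generalize (e 0 : VField M) = e₀ at *
  generalize (e 1 : VField M) = e₁ at *
  generalize (e 2 : VField M) = e₂ at *
  have hmem (a b c : ℝ) : a • e₀ + b • e₁ + c • e₂ ∈ G :=
    add_mem (add_mem (G.smul_mem _ h₀) (G.smul_mem _ h₁)) (G.smul_mem _ h₂)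
  have hkill (X) (hX : X ∈ G) := hG.killing X hX
  have hbr (a b c a' b' c' : ℝ) := bracket_eq_of_heisenberg (hkill _ h₀).1 (hkill _ h₁).1
    (hkill _ h₂).1 h₁₂ h₀₁ h₀₂ a b c a' b' c' fun a b c ↦ (hkill _ (hmem a b c)).1
  have hξ0 := hax.ne_zero (hkill _ hξ).1
  have hnull : g.pair ξ ξ ≠ 0 := hax.exists_pair_self_ne_zero (hkill _ hξ).1
    (hT.mono fun p hp ↦ hG.ne_zero_of_finrank_orbitTangent hp.1 hξ hξ0)
  obtain ⟨p, hp⟩ := hT.nonempty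
  obtain ⟨a, b, c, rfl⟩ := hspan ξ hξ
  obtain ⟨rfl, rfl⟩ := hax.coeff_eq_zero hG hp.1 hp.2 h₀ h₁ h₂ hne h₁₂ h₀₁ h₀₂ hspan
  have hN : g.pair e₀ e₀ ≠ 0 := fun h ↦ hnull <| by
    simp [g.pair_smul_left, g.pair_smul_right, h]
  have hN' (k : ℝ) (hk : k ≠ 0) : g.pair (k • e₀) (k • e₀) ≠ 0 := by
    simpa [g.pair_smul_left, g.pair_smul_right, hk] using hN
  obtain ⟨a', b', c', rfl⟩ := hspan s hs
  by_cases hbc : b' = 0 ∧ c' = 0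
  · obtain ⟨rfl, rfl⟩ := hbc
    by_contra hs0
    simp only [zero_smul, add_zero] at hs hint hs0
    have ha' : a' ≠ 0 := fun h ↦ hs0 (by rw [h, zero_smul])
    refine hN' a' ha' (pair_self_eq_zero_of_integrable_central (hkill _ hs)
      (hkill _ (G.smul_mem a' h₁)) (hkill _ h₂) ?_ ?_ ?_ hint)
    · rw [bracket_smul_left _ _ (hkill _ h₁).1, h₁₂]
    · simpa using hbr a' 0 0 0 a' 0
    · simpa using hbr a' 0 0 0 0 1
  · -- For `f = c' e₁ - b' e₂`, the bracket `[f, s]` is a positive multiple of `e₀`.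
    have hk : c' * c' - -b' * b' ≠ 0 := by
      have : 0 < b' ^ 2 + c' ^ 2 := by
        have : b' ≠ 0 ∨ c' ≠ 0 := not_and_or.1 hbc
        rcases this with h | h <;> positivity
      nlinarith
    refine (hN' _ hk (pair_self_eq_zero_of_integrable_of_bracket (hkill _ hs)
      (hkill _ (hmem 0 c' (-b'))) (hkill _ (G.smul_mem _ h₀)) (hbr 0 c' (-b') a' b' c') ?_ ?_
      hint)).elim
    · simpa using hbr (c' * c' - -b' * b') 0 0 a' b' c'
    · simpa using hbr (c' * c' - -b' * b') 0 0 0 c' (-b')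

end Spacetime

theorem mainTheorem4 {M : Type*} [TopologicalSpace M] [T2Space M] [ConnectedSpace M]
    [ChartedSpace (EuclideanSpace ℝ (Fin 4)) M] [IsManifold (𝓡 4) ∞ M]
    (g : LorentzMetric M) (G K : Submodule ℝ (VField M))
    (hG : IsMotionAlgebra g 3 G) (hT : ActsOnT3 g G) (hII : IsBianchiII G)
    (hK : IsMotionAlgebra g 2 K) (hKG : K ≤ G) (hAb : IsAbelian K)
    (hOT : IsOrthogonallyTransitive g K) (hAx : ∃ ξ ∈ K, IsAxial g ξ) :
    (∀ s ∈ G, IsIntegrable g s → s ∈ K) ∧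
      ¬ ∃ s ∈ G, IsIntegrable g s ∧ ∃ p : M, g.pair s s p < 0 := by
  obtain ⟨ξ, hξ, hax⟩ := hAx
  have hzero (s) (hs : s ∈ G) (hint : IsIntegrable g s) : s = 0 :=
    eq_zero_of_integrable_of_axial hG hT hII (hKG hξ) hax hs hint
  refine ⟨fun s hs hint ↦ hzero s hs hint ▸ K.zero_mem, ?_⟩
  rintro ⟨s, hs, hint, p, hp⟩
  simp [hzero s hs hint] at hp
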